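/- Let $(M,g)$ be a smooth Riemannian manifold of dimension $n\ge 1$ (without boundary), let $U\subseteq M$ be open (for example $U=M$), and let $\{E_i\}_{i=1}^n$ be a smooth orthonormal frame for $g$ over $U$ with dual coframe $\{\theta^i\}$. Write $R^g(X,Y,Z,W)=g(\nabla_X\nabla_YZ-\nabla_Y\nabla_XZ-\nabla_{[X,Y]}Z,\,W)$, where $\nabla$ is the Levi-Civita connection of $g$. Then for every compact set $K\subseteq U$ and every $\varepsilon>0$ there is $\delta>0$, depending only on $(M,g)$, $U$, the frame, $K$ and $\varepsilon$, such that the following holds. Let $\phi^i,\psi^i,\lambda^i$ $(1\le i\le n)$ be smooth functions on $U$ with $$d\phi^i=\psi^i\theta^1,\qquad d\psi^i=\lambda^i\theta^1 ,$$ and let $\tilde g$ be a smooth Riemannian metric for which $\tilde\theta^i=\phi^i\theta^i$ is an orthonormal coframe over $U$, i.e. the frame $\{\tilde E_i\}$ dual to $\{\tilde\theta^i\}$ is $\tilde g$-orthonormal. If $x\in K$ is a point at which all the $\phi^i$ are $\delta$-close to $1$ to first order, that is, $$|\phi^i(x)-1|<\delta\quad\text{and}\quad |d\phi^i(v)|\le\delta\,|v|_g\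 \text{ for all } v\in T_xM,\qquad 1\le i\le n,$$ then $$\bigl|R^{\tilde g}(\tilde E_i,\tilde E_j,\tilde E_k,\tilde E_l)(x)-R^{g}(E_i,E_j,E_k,E_l)(x)\bigr|<\varepsilon$$ for all indices $(i,j,k,l)$, except possibly those for which the symmetries $R(X,Y,Z,W)=-R(Y,X,Z,W)=-R(X,Y,W,Z)=R(Z,W,X,Y)$ of the curvature tensor reduce $R^{\tilde g}(\tilde E_i,\tilde E_j,\tilde E_k,\tilde E_l)$ to a component of the form $R^{\tilde g}(\tilde E_1,\tilde E_m,\tilde E_m,\tilde E_1)$. In particular, if the $\phi^i$ are $\delta$-close to $1$ in the $C^1$-topology on $K$, then all these components are uniformly $\varepsilon$-close on $K$; no bound on the $\lambda^i$ is required. -/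

import Mathlib

open Set Manifold Bundle
open scoped ContDiff Topology

noncomputable section

/-- A smooth Riemannian metric on a smooth `n`-manifold `M` (without boundary). -/
abbrev SmoothMetric (n : ℕ) (M : Type*) [TopologicalSpace M]
    [ChartedSpace (EuclideanSpace ℝ (Fin n)) M] [IsManifold (𝓡 n) ∞ M] :=
  ContMDiffRiemannianMetric (𝓡 n) ∞ (EuclideanSpace ℝ (Fin n))
    (fun x : M => TangentSpace (𝓡 n) x)

/-- A vector field on `M`; no regularity is built in, and the constructions below only use its
germ at the point under consideration, so fields given on an open set are admitted. -/
abbrev VField (n : ℕ) (M : Type*) [TopologicalSpace M]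
    [ChartedSpace (EuclideanSpace ℝ (Fin n)) M] :=
  (x : M) → TangentSpace (𝓡 n) x

section Geometry

variable {n : ℕ} {M : Type*} [TopologicalSpace M] [ChartedSpace (EuclideanSpace ℝ (Fin n)) M]
  [IsManifold (𝓡 n) ∞ M]

/-- `X` is differentiable at `x`. -/
def VField.DiffAt (X : VField n M) (x : M) : Prop :=
  MDifferentiableAt (𝓡 n) (𝓡 n).tangent (fun y => (⟨y, X y⟩ : TangentBundle (𝓡 n) M)) x

/-- `X` is smooth on `U`. -/
def VField.SmoothOn (X : VField n M) (U : Set M) : Prop :=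
  ContMDiffOn (𝓡 n) (𝓡 n).tangent ∞ (fun y => (⟨y, X y⟩ : TangentBundle (𝓡 n) M)) U

/-- The function `g(X, Y)`. -/
def metricPair (g : SmoothMetric n M) (X Y : VField n M) (x : M) : ℝ := g.inner x (X x) (Y x)

/-- The right-hand side of the Koszul formula for `g(∇_X Y, Z)`. -/
def koszul (g : SmoothMetric n M) (X Y Z : VField n M) (x : M) : ℝ :=
  (mvfderiv (𝓡 n) (metricPair g Y Z) x (X x)
    + mvfderiv (𝓡 n) (metricPair g Z X) x (Y x)
    - mvfderiv (𝓡 n) (metricPair g X Y) x (Z x)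
    + g.inner x (VectorField.mlieBracket (𝓡 n) X Y x) (Z x)
    - g.inner x (VectorField.mlieBracket (𝓡 n) Y Z x) (X x)
    + g.inner x (VectorField.mlieBracket (𝓡 n) Z X x) (Y x)) / 2

/-- The Levi-Civita covariant derivative `∇_X Y` of `g`: at each point where `X` and `Y` are
differentiable it is the unique vector satisfying the Koszul formula against all differentiable
`Z` (see `leviCivita_spec`, `eq_leviCivita`). -/
def leviCivita (g : SmoothMetric n M) (X Y : VField n M) : VField n M := fun x =>
  Classical.epsilon fun v : TangentSpace (𝓡 n) x =>
    ∀ Z : VField n M, Z.DiffAt x → g.inner x v (Z x) = koszul g X Y Z x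

/-- `R(X, Y, Z, W) = g(∇_X ∇_Y Z - ∇_Y ∇_X Z - ∇_{[X,Y]} Z, W)`, so that `R(X, W, W, X)` is
the sectional curvature of an orthonormal pair `X, W`. -/
def riemannCurvature (g : SmoothMetric n M) (X Y Z W : VField n M) (x : M) : ℝ :=
  g.inner x
    (leviCivita g X (leviCivita g Y Z) x - leviCivita g Y (leviCivita g X Z) x
      - leviCivita g (VectorField.mlieBracket (𝓡 n) X Y) Z x) (W x)

/-- `E` is a smooth orthonormal frame for `g` over `U`. -/
structure IsOrthonormalFrame (g : SmoothMetric n M) (U : Set M) (E : Fin n → VField n M) :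
    Prop where
  smooth : ∀ i, (E i).SmoothOn U
  orthonormal : ∀ x ∈ U, ∀ i j, g.inner x (E i x) (E j x) = if i = j then 1 else 0

/-- `θ` is the coframe over `U` dual to the frame `E`. -/
def IsDualCoframe (U : Set M) (E : Fin n → VField n M)
    (θ : Fin n → (x : M) → TangentSpace (𝓡 n) x →L[ℝ] ℝ) : Prop :=
  ∀ x ∈ U, ∀ i j, θ i x (E j x) = if i = j then 1 else 0

/-- At the point `x`, the function `φ` is within `δ` of the constant `1` to first order, the
differential being measured in the norm of `g`. -/
def C1CloseToOneAt (g : SmoothMetric n M) (δ : ℝ) (φ : M → ℝ) (x : M) : Prop :=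
  |φ x - 1| < δ ∧ ∀ v : TangentSpace (𝓡 n) x, |mvfderiv (𝓡 n) φ x v| ≤ δ * √(g.inner x v v)

/-- The index quadruples `(i, j, k, l)` that the symmetries
`R(X,Y,Z,W) = -R(Y,X,Z,W) = -R(X,Y,W,Z) = R(Z,W,X,Y)` of the curvature tensor reduce to
a quadruple of the form `(o, m, m, o)`. -/
inductive ReducesTo (o : Fin n) : Fin n → Fin n → Fin n → Fin n → Prop
  | base (m : Fin n) : ReducesTo o o m m o
  | swapLeft {i j k l : Fin n} : ReducesTo o i j k l → ReducesTo o j i k l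
  | swapRight {i j k l : Fin n} : ReducesTo o i j k l → ReducesTo o i j l k
  | swapPairs {i j k l : Fin n} : ReducesTo o i j k l → ReducesTo o k l i j

/-! ### The Levi-Civita derivative is well defined, metric and torsion-free -/

theorem metricPair_diffAt (g : SmoothMetric n M) {X Y : VField n M} {x : M}
    (hX : X.DiffAt x) (hY : Y.DiffAt x) :
    MDifferentiableAt (𝓡 n) 𝓘(ℝ, ℝ) (metricPair g X Y) x := by
  have hg := g.contMDiff.mdifferentiableAt (by simp) (x := x)
  have h := MDifferentiableAt.clm_bundle_apply₂ (F₁ := EuclideanSpace ℝ (Fin n))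
    (F₂ := EuclideanSpace ℝ (Fin n)) (F₃ := ℝ) (E₃ := Bundle.Trivial M ℝ)
    (b := fun m => m) hg hX hY
  simp only [mdifferentiableAt_totalSpace] at h
  exact h.2

theorem koszul_tensorial (g : SmoothMetric n M) {X Y : VField n M} {x : M}
    (hX : X.DiffAt x) (hY : Y.DiffAt x) :
    TensorialAt (𝓡 n) (EuclideanSpace ℝ (Fin n)) (fun Z : VField n M => koszul g X Y Z x) x where
  smul {f Z} hf hZ := by
    have h1 : metricPair g Y (f • Z) = f * metricPair g Y Z := by
      ext y; simp [metricPair]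
    have h2 : metricPair g (f • Z) X = f * metricPair g Z X := by
      ext y; simp [metricPair]
    simp only [koszul, h1, h2, mvfderiv_mul hf (metricPair_diffAt g hY hZ),
      mvfderiv_mul hf (metricPair_diffAt g hZ hX), VectorField.mlieBracket_smul_right hf hZ,
      VectorField.mlieBracket_smul_left hf hZ]
    simp [metricPair, g.symm x (Z x)]
    ring
  add {Z Z'} hZ hZ' := by
    have h1 : metricPair g Y (Z + Z') = metricPair g Y Z + metricPair g Y Z' := by
      ext y; simp [metricPair]
    have h2 : metricPair g (Z + Z') X = metricPair g Z X + metricPair g Z' X := by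
      ext y; simp [metricPair]
    simp only [koszul, h1, h2, mvfderiv_add (metricPair_diffAt g hY hZ) (metricPair_diffAt g hY hZ'),
      mvfderiv_add (metricPair_diffAt g hZ hX) (metricPair_diffAt g hZ' hX),
      VectorField.mlieBracket_add_right hZ hZ', VectorField.mlieBracket_add_left hZ hZ']
    simp
    ring

theorem metric_ext (g : SmoothMetric n M) {x : M} {v w : TangentSpace (𝓡 n) x}
    (h : ∀ z, g.inner x v z = g.inner x w z) : v = w := by
  by_contra hne
  have := g.pos x (v - w) (sub_ne_zero.2 hne)
  simp [h] at this

theorem exists_diffAt_extend {x : M} (z : TangentSpace (𝓡 n) x) :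
    ∃ Z : VField n M, Z.DiffAt x ∧ Z x = z :=
  ⟨FiberBundle.extend (EuclideanSpace ℝ (Fin n)) z,
    FiberBundle.mdifferentiableAt_extend .., by simp⟩

theorem leviCivita_spec (g : SmoothMetric n M) {X Y Z : VField n M} {x : M}
    (hX : X.DiffAt x) (hY : Y.DiffAt x) (hZ : Z.DiffAt x) :
    g.inner x (leviCivita g X Y x) (Z x) = koszul g X Y Z x := by
  have hT := koszul_tensorial g hX hY
  have : FiniteDimensional ℝ (TangentSpace (𝓡 n) x) :=
    inferInstanceAs (FiniteDimensional ℝ (EuclideanSpace ℝ (Fin n)))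
  let L : TangentSpace (𝓡 n) x →ₗ[ℝ] Module.Dual ℝ (TangentSpace (𝓡 n) x) :=
    { toFun := fun v => (g.inner x v : TangentSpace (𝓡 n) x →ₗ[ℝ] ℝ)
      map_add' := fun v w => by ext; simp
      map_smul' := fun c v => by ext; simp }
  have hinj : Function.Injective L := fun v w h =>
    metric_ext g fun z => congrArg (fun T : Module.Dual ℝ (TangentSpace (𝓡 n) x) => T z) h
  have hsurj : Function.Surjective L :=
    (LinearMap.injective_iff_surjective_of_finrank_eq_finrank
      Subspace.dual_finrank_eq.symm).1 hinj
  obtain ⟨v, hv⟩ := hsurj (TensorialAt.mkHom _ x hT : TangentSpace (𝓡 n) x →ₗ[ℝ] ℝ)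
  have hex : ∃ v : TangentSpace (𝓡 n) x,
      ∀ Z : VField n M, Z.DiffAt x → g.inner x v (Z x) = koszul g X Y Z x :=
    ⟨v, fun Z hZ => (congrArg (fun T : Module.Dual ℝ (TangentSpace (𝓡 n) x) => T (Z x)) hv).trans
      (TensorialAt.mkHom_apply hT hZ)⟩
  exact Classical.epsilon_spec hex Z hZ

theorem eq_leviCivita (g : SmoothMetric n M) {X Y : VField n M} {x : M}
    (hX : X.DiffAt x) (hY : Y.DiffAt x) {v : TangentSpace (𝓡 n) x}
    (hv : ∀ Z : VField n M, Z.DiffAt x → g.inner x v (Z x) = koszul g X Y Z x) :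
    v = leviCivita g X Y x := by
  refine metric_ext g fun z => ?_
  obtain ⟨Z, hZ, rfl⟩ := exists_diffAt_extend z
  rw [hv Z hZ, leviCivita_spec g hX hY hZ]

theorem metricPair_comm (g : SmoothMetric n M) (X Y : VField n M) :
    metricPair g X Y = metricPair g Y X :=
  funext fun x => g.symm x _ _

theorem leviCivita_metric (g : SmoothMetric n M) {X Y Z : VField n M} {x : M}
    (hX : X.DiffAt x) (hY : Y.DiffAt x) (hZ : Z.DiffAt x) :
    mvfderiv (𝓡 n) (metricPair g Y Z) x (X x)
      = g.inner x (leviCivita g X Y x) (Z x) + g.inner x (Y x) (leviCivita g X Z x) := by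
  rw [g.symm x (Y x), leviCivita_spec g hX hY hZ, leviCivita_spec g hX hZ hY]
  simp only [koszul, metricPair_comm g Z Y, metricPair_comm g Y X, metricPair_comm g X Z,
    VectorField.mlieBracket_swap_apply (V := Z) (W := Y),
    VectorField.mlieBracket_swap_apply (V := Y) (W := X),
    VectorField.mlieBracket_swap_apply (V := X) (W := Z)]
  simp
  ring

theorem leviCivita_torsion_free (g : SmoothMetric n M) {X Y : VField n M} {x : M}
    (hX : X.DiffAt x) (hY : Y.DiffAt x) :
    leviCivita g X Y x - leviCivita g Y X x = VectorField.mlieBracket (𝓡 n) X Y x := by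
  refine metric_ext g fun z => ?_
  obtain ⟨Z, hZ, rfl⟩ := exists_diffAt_extend z
  rw [map_sub, _root_.sub_apply, leviCivita_spec g hX hY hZ,
    leviCivita_spec g hY hX hZ]
  simp only [koszul, metricPair_comm g Z X, metricPair_comm g Y X, metricPair_comm g Z Y,
    VectorField.mlieBracket_swap_apply (V := Z) (W := Y),
    VectorField.mlieBracket_swap_apply (V := Y) (W := X),
    VectorField.mlieBracket_swap_apply (V := X) (W := Z)]
  simp
  ring

end Geometry

end

/-! In an orthonormal frame the Koszul formula contains only bracket terms, so the curvature
components are a universal expression `curvForm c d`: quadratic in the structure functions `c i j k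
= g([E_i, E_j], E_k)` and linear in their frame derivatives `d` (`riemannCurvature_eq_curvForm`).

The new frame is `E'_i = u_i E_i` with `u_i = (φ_i)⁻¹`. By the Leibniz rule its structure functions
are rational in `φ`, `ψ` and the old ones (`structureFun_eq`), and `ψ` enters only where a lower
index is `0` and the other equals the upper one. Differentiating once more produces `λ`, linearly,
in those entries and only along `E'_0` (`mvfderiv_structureFun`). Curvature antisymmetrizes this
derivative in `i, j`, so `λ` survives only if exactly one of `i, j` is `0` and `k, l` are the same
two indices in some order: the excluded components (`connCoeff_secondOrderTerm_sub`).

What remains is continuous in `φ`, `ψ` and the point, and equals the old curvature at `φ = 1`, `ψ =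
0`. Compactness of `K` makes the estimate uniform (`exists_curvForm_rescaled_sub_lt`). -/

noncomputable section

/-! ### Calculus of directional derivatives of real functions. -/

section DirectionalDerivative

variable {n : ℕ} {M : Type*} [TopologicalSpace M] [ChartedSpace (EuclideanSpace ℝ (Fin n)) M]

/-- `f` is differentiable at `x` with derivative `d` in the direction `v`. -/
def HasDirDeriv (f : M → ℝ) (x : M) (v : TangentSpace (𝓡 n) x) (d : ℝ) : Prop :=
  MDifferentiableAt (𝓡 n) 𝓘(ℝ, ℝ) f x ∧ mvfderiv (𝓡 n) f x v = d

theorem mvfderiv_congr_of_eventuallyEq {f h : M → ℝ} {x : M} (hfh : f =ᶠ[𝓝 x] h) :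
    mvfderiv (𝓡 n) f x = mvfderiv (𝓡 n) h x := by
  ext v
  simp only [mvfderiv, hfh.mfderiv_eq]
  rfl

namespace HasDirDeriv

variable {f h : M → ℝ} {x : M} {v : TangentSpace (𝓡 n) x} {a b : ℝ}

theorem of_mdifferentiableAt (hf : MDifferentiableAt (𝓡 n) 𝓘(ℝ, ℝ) f x) :
    HasDirDeriv f x v (mvfderiv (𝓡 n) f x v) := ⟨hf, rfl⟩

theorem congr_val (hf : HasDirDeriv f x v a) (hab : a = b) : HasDirDeriv f x v b := hab ▸ hf

theorem congr_of_eventuallyEq (hf : HasDirDeriv f x v a) (hh : h =ᶠ[𝓝 x] f) :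
    HasDirDeriv h x v a :=
  ⟨hf.1.congr_of_eventuallyEq hh, by rw [mvfderiv_congr_of_eventuallyEq hh]; exact hf.2⟩

theorem const (c : ℝ) : HasDirDeriv (fun _ : M => c) x v 0 :=
  ⟨mdifferentiableAt_const, by rw [mvfderiv_const]; rfl⟩

theorem add (hf : HasDirDeriv f x v a) (hh : HasDirDeriv h x v b) :
    HasDirDeriv (fun y => f y + h y) x v (a + b) :=
  ⟨hf.1.add hh.1, by
    change mvfderiv (𝓡 n) (f + h) x v = _
    rw [mvfderiv_add hf.1 hh.1, ← hf.2, ← hh.2]; rfl⟩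

theorem mul (hf : HasDirDeriv f x v a) (hh : HasDirDeriv h x v b) :
    HasDirDeriv (fun y => f y * h y) x v (a * h x + f x * b) :=
  ⟨hf.1.mul hh.1, by
    change mvfderiv (𝓡 n) (f * h) x v = _
    rw [mvfderiv_mul hf.1 hh.1, ← hf.2, ← hh.2]
    simp
    ring⟩

theorem const_mul (c : ℝ) (hf : HasDirDeriv f x v a) :
    HasDirDeriv (fun y => c * f y) x v (c * a) :=
  ((const c).mul hf).congr_val (by simp)

theorem neg (hf : HasDirDeriv f x v a) : HasDirDeriv (fun y => -f y) x v (-a) := by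
  simpa using hf.const_mul (-1)

theorem sub (hf : HasDirDeriv f x v a) (hh : HasDirDeriv h x v b) :
    HasDirDeriv (fun y => f y - h y) x v (a - b) := by
  simpa only [sub_eq_add_neg] using hf.add hh.neg

theorem inv (hf : HasDirDeriv f x v a) (hx : f x ≠ 0) :
    HasDirDeriv (fun y => (f y)⁻¹) x v (-((f x)⁻¹ * (f x)⁻¹ * a)) := by
  have hd : MDifferentiableAt (𝓡 n) 𝓘(ℝ, ℝ) (fun y => (f y)⁻¹) x :=
    (differentiableAt_inv hx).mdifferentiableAt.comp x hf.1
  refine ⟨hd, ?_⟩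
  -- The value comes from differentiating `f * f⁻¹ = 1`, which holds near `x` by continuity.
  have h1 : HasDirDeriv (fun y => f y * (f y)⁻¹) x v
      (a * (f x)⁻¹ + f x * mvfderiv (𝓡 n) (fun y => (f y)⁻¹) x v) :=
    hf.mul (of_mdifferentiableAt hd)
  have h2 : HasDirDeriv (fun y => f y * (f y)⁻¹) x v 0 := by
    refine (const 1).congr_of_eventuallyEq ?_
    filter_upwards [hf.1.continuousAt.eventually_ne hx] with y hy using mul_inv_cancel₀ hy
  have h3 := h1.2.symm.trans h2.2
  field_simp at h3 ⊢
  linarith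

end HasDirDeriv

end DirectionalDerivative

/-! ### Connection and curvature in an orthonormal frame. -/

section Frame

variable {n : ℕ} {M : Type*} [TopologicalSpace M] [ChartedSpace (EuclideanSpace ℝ (Fin n)) M]
  [IsManifold (𝓡 n) ∞ M]

theorem VField.SmoothOn.contMDiffAt {X : VField n M} {U : Set M} (hX : X.SmoothOn U)
    (hU : IsOpen U) {x : M} (hx : x ∈ U) :
    ContMDiffAt (𝓡 n) (𝓡 n).tangent ∞ (fun y => (⟨y, X y⟩ : TangentBundle (𝓡 n) M)) x :=
  (hX x hx).contMDiffAt (hU.mem_nhds hx)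

theorem VField.SmoothOn.diffAt {X : VField n M} {U : Set M} (hX : X.SmoothOn U)
    (hU : IsOpen U) {x : M} (hx : x ∈ U) : X.DiffAt x :=
  (hX.contMDiffAt hU hx).mdifferentiableAt (by simp)

theorem VField.SmoothOn.mlieBracket {X Y : VField n M} {U : Set M} (hX : X.SmoothOn U)
    (hY : Y.SmoothOn U) (hU : IsOpen U) :
    VField.SmoothOn (VectorField.mlieBracket (𝓡 n) X Y) U := fun x hx => by
  refine ContMDiffAt.contMDiffWithinAt ?_
  have : IsManifold (𝓡 n) (((⊤ : ℕ∞) : WithTop ℕ∞) + 1) M := by simpa using ‹IsManifold (𝓡 n) ∞ M›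
  have : IsManifold (𝓡 n) (minSmoothness ℝ 2) M := by
    rw [minSmoothness_of_isRCLikeNormedField]; infer_instance
  exact ContMDiffAt.mlieBracket_vectorField (n := ⊤) (m := ⊤) (hX.contMDiffAt hU hx)
    (hY.contMDiffAt hU hx) (by simp)

theorem metricPair_contMDiffOn (g : SmoothMetric n M) {X Y : VField n M} {U : Set M}
    (hX : X.SmoothOn U) (hY : Y.SmoothOn U) :
    ContMDiffOn (𝓡 n) 𝓘(ℝ, ℝ) ∞ (metricPair g X Y) U := by
  have h := ContMDiffOn.clm_bundle_apply₂ (F₁ := EuclideanSpace ℝ (Fin n))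
    (F₂ := EuclideanSpace ℝ (Fin n)) (F₃ := ℝ) (E₃ := Bundle.Trivial M ℝ)
    (b := fun m => m) (g.contMDiff.contMDiffOn (s := U)) hX hY
  intro x hx
  have := h x hx
  simp only [contMDiffWithinAt_totalSpace] at this
  exact this.2

/-- Allows `∇_{[E_i, E_j]} E_k` to be expanded from the value of the bracket at the point alone. -/
theorem koszul_tensorial_left (g : SmoothMetric n M) {Y Z : VField n M} {x : M}
    (hY : Y.DiffAt x) (hZ : Z.DiffAt x) :
    TensorialAt (𝓡 n) (EuclideanSpace ℝ (Fin n)) (fun X : VField n M => koszul g X Y Z x) x where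
  smul {f X} hf hX := by
    have h1 : metricPair g (f • X) Y = f * metricPair g X Y := by
      ext y; simp [metricPair]
    have h2 : metricPair g Z (f • X) = f * metricPair g Z X := by
      ext y; simp [metricPair]
    simp only [koszul, h1, h2, mvfderiv_mul hf (metricPair_diffAt g hX hY),
      mvfderiv_mul hf (metricPair_diffAt g hZ hX), VectorField.mlieBracket_smul_right hf hX,
      VectorField.mlieBracket_smul_left hf hX]
    simp [metricPair, g.symm x (X x)]
    ring
  add {X X'} hX hX' := by
    have h1 : metricPair g (X + X') Y = metricPair g X Y + metricPair g X' Y := by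
      ext y; simp [metricPair]
    have h2 : metricPair g Z (X + X') = metricPair g Z X + metricPair g Z X' := by
      ext y; simp [metricPair]
    simp only [koszul, h1, h2, mvfderiv_add (metricPair_diffAt g hX hY) (metricPair_diffAt g hX' hY),
      mvfderiv_add (metricPair_diffAt g hZ hX) (metricPair_diffAt g hZ hX'),
      VectorField.mlieBracket_add_right hX hX', VectorField.mlieBracket_add_left hX hX']
    simp
    ring

/-- The structure functions `g([E_i, E_j], E_k)` of a frame. -/
def structureFun (g : SmoothMetric n M) (E : Fin n → VField n M) (i j k : Fin n) : M → ℝ :=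
  metricPair g (VectorField.mlieBracket (𝓡 n) (E i) (E j)) (E k)

/-- The connection coefficients `g(∇_{E_i} E_j, E_k)` of an orthonormal frame with structure
constants `c`. -/
def connCoeff (c : Fin n → Fin n → Fin n → ℝ) (i j k : Fin n) : ℝ :=
  (c i j k - c j k i + c k i j) / 2

/-- The curvature components of an orthonormal frame with structure constants `c`, whose
derivatives are `d a i j k = E_a (c i j k)`. -/
def curvForm (c : Fin n → Fin n → Fin n → ℝ) (d : Fin n → Fin n → Fin n → Fin n → ℝ)
    (i j k l : Fin n) : ℝ :=
  connCoeff (d i) j k l - ∑ m, connCoeff c j k m * connCoeff c i l m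
    - (connCoeff (d j) i k l - ∑ m, connCoeff c i k m * connCoeff c j l m)
    - ∑ m, c i j m * connCoeff c m k l

namespace IsOrthonormalFrame

variable {g : SmoothMetric n M} {U : Set M} {E : Fin n → VField n M}

theorem exists_sum_eq (hE : IsOrthonormalFrame g U E) {x : M} (hx : x ∈ U)
    (v : TangentSpace (𝓡 n) x) : ∑ i, g.inner x v (E i x) • E i x = v := by
  have : FiniteDimensional ℝ (TangentSpace (𝓡 n) x) :=
    inferInstanceAs (FiniteDimensional ℝ (EuclideanSpace ℝ (Fin n)))
  have hfr : Module.finrank ℝ (TangentSpace (𝓡 n) x) = n :=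
    (finrank_euclideanSpace_fin : Module.finrank ℝ (EuclideanSpace ℝ (Fin n)) = n)
  have hli : LinearIndependent ℝ (fun i => E i x) := by
    rw [Fintype.linearIndependent_iff]
    intro a ha i
    have := congrArg (fun w => g.inner x w (E i x)) ha
    simpa [hE.orthonormal x hx] using this
  have hspan := hli.span_eq_top_of_card_eq_finrank' (by simp [hfr])
  have hv : v ∈ Submodule.span ℝ (Set.range fun i => E i x) := hspan ▸ Submodule.mem_top
  obtain ⟨a, rfl⟩ := (Submodule.mem_span_range_iff_exists_fun ℝ).1 hv
  refine Finset.sum_congr rfl fun i _ => ?_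
  simp [hE.orthonormal x hx]

theorem inner_eq_sum (hE : IsOrthonormalFrame g U E) {x : M} (hx : x ∈ U)
    (v w : TangentSpace (𝓡 n) x) :
    g.inner x v w = ∑ m, g.inner x v (E m x) * g.inner x w (E m x) := by
  conv_lhs => rw [← hE.exists_sum_eq hx w]
  simp [mul_comm]

theorem diffAt (hE : IsOrthonormalFrame g U E) (hU : IsOpen U) {x : M} (hx : x ∈ U) (i : Fin n) :
    (E i).DiffAt x := (hE.smooth i).diffAt hU hx

theorem structureFun_contMDiffOn (hE : IsOrthonormalFrame g U E) (hU : IsOpen U) (i j k : Fin n) :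
    ContMDiffOn (𝓡 n) 𝓘(ℝ, ℝ) ∞ (structureFun g E i j k) U :=
  metricPair_contMDiffOn g ((hE.smooth i).mlieBracket (hE.smooth j) hU) (hE.smooth k)

theorem structureFun_diffAt (hE : IsOrthonormalFrame g U E) (hU : IsOpen U) {x : M} (hx : x ∈ U)
    (i j k : Fin n) : MDifferentiableAt (𝓡 n) 𝓘(ℝ, ℝ) (structureFun g E i j k) x :=
  ((hE.structureFun_contMDiffOn hU i j k).contMDiffAt (hU.mem_nhds hx)).mdifferentiableAt (by simp)

/-- The products `g(E_i, E_j)` are locally constant, so the derivative terms vanish and the brackets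
remain. -/
theorem koszul_eq_connCoeff (hE : IsOrthonormalFrame g U E) (hU : IsOpen U) {x : M} (hx : x ∈ U)
    (i j k : Fin n) :
    koszul g (E i) (E j) (E k) x = connCoeff (fun i j k => structureFun g E i j k x) i j k := by
  have hd (i j : Fin n) : mvfderiv (𝓡 n) (metricPair g (E i) (E j)) x = 0 := by
    rw [mvfderiv_congr_of_eventuallyEq (h := fun _ => if i = j then 1 else 0), mvfderiv_const]
    filter_upwards [hU.mem_nhds hx] with y hy using hE.orthonormal y hy i j
  simp [koszul, hd, connCoeff, structureFun, metricPair]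

theorem inner_leviCivita (hE : IsOrthonormalFrame g U E) (hU : IsOpen U) {x : M} (hx : x ∈ U)
    (i j k : Fin n) :
    g.inner x (leviCivita g (E i) (E j) x) (E k x)
      = connCoeff (fun i j k => structureFun g E i j k x) i j k := by
  rw [leviCivita_spec g (hE.diffAt hU hx i) (hE.diffAt hU hx j) (hE.diffAt hU hx k),
    hE.koszul_eq_connCoeff hU hx]

theorem connCoeff_hasDirDeriv (hE : IsOrthonormalFrame g U E) (hU : IsOpen U) {x : M} (hx : x ∈ U)
    (v : TangentSpace (𝓡 n) x) (i j k : Fin n) :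
    HasDirDeriv (fun y => connCoeff (fun i j k => structureFun g E i j k y) i j k) x v
      (connCoeff (fun i j k => mvfderiv (𝓡 n) (structureFun g E i j k) x v) i j k) := by
  have h (i j k : Fin n) : HasDirDeriv (structureFun g E i j k) x v _ :=
    .of_mdifferentiableAt (hE.structureFun_diffAt hU hx i j k)
  refine ((((h i j k).sub (h j k i)).add (h k i j)).mul (.const 2⁻¹)).congr_val ?_
  simp [connCoeff, div_eq_mul_inv]

/-- `leviCivita` is chosen point by point, so its regularity must be read off from its frame
expansion, whose coefficients are differentiable. -/
theorem leviCivita_diffAt (hE : IsOrthonormalFrame g U E) (hU : IsOpen U) {x : M} (hx : x ∈ U)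
    (i j : Fin n) : VField.DiffAt (leviCivita g (E i) (E j)) x := by
  have h : VField.DiffAt (fun y => ∑ k,
      connCoeff (fun i j k => structureFun g E i j k y) i j k • E k y) x :=
    MDifferentiableAt.sum_section fun k _ =>
      (hE.connCoeff_hasDirDeriv hU hx 0 i j k).1.smul_section (hE.diffAt hU hx k)
  refine h.congr_of_eventuallyEq ?_
  filter_upwards [hU.mem_nhds hx] with y hy
  simp only [← hE.inner_leviCivita hU hy, hE.exists_sum_eq hy]

/-- Metric compatibility: differentiate `g(∇_j E_k, E_l)` along `E_i` and move `g(∇_j E_k, ∇_i E_l)`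
to the other side. -/
theorem inner_leviCivita_leviCivita (hE : IsOrthonormalFrame g U E) (hU : IsOpen U) {x : M}
    (hx : x ∈ U) (i j k l : Fin n) :
    g.inner x (leviCivita g (E i) (leviCivita g (E j) (E k)) x) (E l x)
      = connCoeff (fun p q r => mvfderiv (𝓡 n) (structureFun g E p q r) x (E i x)) j k l
        - ∑ m, connCoeff (fun i j k => structureFun g E i j k x) j k m
          * connCoeff (fun i j k => structureFun g E i j k x) i l m := by
  have h := leviCivita_metric g (hE.diffAt hU hx i) (hE.leviCivita_diffAt hU hx j k)
    (hE.diffAt hU hx l)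
  rw [hE.inner_eq_sum hx (leviCivita g (E j) (E k) x)] at h
  simp only [hE.inner_leviCivita hU hx] at h
  rw [← ((hE.connCoeff_hasDirDeriv hU hx (E i x) j k l).congr_of_eventuallyEq
    (h := metricPair g (leviCivita g (E j) (E k)) (E l)) ?_).2, h]
  · ring
  · filter_upwards [hU.mem_nhds hx] with y hy using hE.inner_leviCivita hU hy j k l

theorem riemannCurvature_eq_curvForm (hE : IsOrthonormalFrame g U E) (hU : IsOpen U) {x : M}
    (hx : x ∈ U) (i j k l : Fin n) :
    riemannCurvature g (E i) (E j) (E k) (E l) x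
      = curvForm (fun i j k => structureFun g E i j k x)
        (fun a i j k => mvfderiv (𝓡 n) (structureFun g E i j k) x (E a x)) i j k l := by
  have hb := (((hE.smooth i).mlieBracket (hE.smooth j) hU)).diffAt hU hx
  have hT := koszul_tensorial_left g (hE.diffAt hU hx k) (hE.diffAt hU hx l)
  have h3 : g.inner x (leviCivita g (VectorField.mlieBracket (𝓡 n) (E i) (E j)) (E k) x) (E l x)
      = ∑ m, structureFun g E i j m x
        * connCoeff (fun i j k => structureFun g E i j k x) m k l := by
    rw [leviCivita_spec g hb (hE.diffAt hU hx k) (hE.diffAt hU hx l)]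
    rw [← TensorialAt.mkHom_apply hT hb, ← hE.exists_sum_eq hx (VectorField.mlieBracket _ _ _ x),
      map_sum]
    refine Finset.sum_congr rfl fun m _ => ?_
    rw [map_smul, TensorialAt.mkHom_apply hT (hE.diffAt hU hx m), hE.koszul_eq_connCoeff hU hx]
    rfl
  rw [riemannCurvature, map_sub, map_sub, _root_.sub_apply, _root_.sub_apply, h3,
    hE.inner_leviCivita_leviCivita hU hx, hE.inner_leviCivita_leviCivita hU hx]
  rfl

/-- Since `[X, f X] = (X f) X`, the derivative of a smooth function along a unit field is smooth. -/
theorem mvfderiv_contMDiffOn (hE : IsOrthonormalFrame g U E) (hU : IsOpen U) {f : M → ℝ}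
    (hf : ContMDiffOn (𝓡 n) 𝓘(ℝ, ℝ) ∞ f U) (i : Fin n) :
    ContMDiffOn (𝓡 n) 𝓘(ℝ, ℝ) ∞ (fun x => mvfderiv (𝓡 n) f x (E i x)) U := by
  have hfE : VField.SmoothOn (f • E i) U := hf.smul_section (hE.smooth i)
  refine (metricPair_contMDiffOn g ((hE.smooth i).mlieBracket hfE hU) (hE.smooth i)).congr ?_
  intro x hx
  have hfx := (hf.contMDiffAt (hU.mem_nhds hx)).mdifferentiableAt (by simp)
  simp [metricPair, VectorField.mlieBracket_smul_right hfx (hE.diffAt hU hx i),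
    hE.orthonormal x hx]

end IsOrthonormalFrame

end Frame

/-! ### Algebra and continuity of rescaled structure constants. -/

section StructureConstants

variable {n : ℕ}

/-- The quadratic terms do not involve `d`, so the second-order part `e` splits off linearly. -/
theorem curvForm_add (c : Fin n → Fin n → Fin n → ℝ) (d e : Fin n → Fin n → Fin n → Fin n → ℝ)
    (i j k l : Fin n) :
    curvForm c (fun a i j k => d a i j k + e a i j k) i j k l
      = curvForm c d i j k l + (connCoeff (e i) j k l - connCoeff (e j) i k l) := by
  simp only [curvForm, connCoeff]
  ring

theorem ContinuousAt.curvForm {T : Type*} [TopologicalSpace T] {t : T}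
    {c : T → Fin n → Fin n → Fin n → ℝ} {d : T → Fin n → Fin n → Fin n → Fin n → ℝ}
    (hc : ∀ i j k, ContinuousAt (fun y => c y i j k) t)
    (hd : ∀ a i j k, ContinuousAt (fun y => d y a i j k) t) (i j k l : Fin n) :
    ContinuousAt (fun y => curvForm (c y) (d y) i j k l) t := by
  unfold _root_.curvForm connCoeff
  fun_prop

variable [NeZero n]

/-- The part of the structure constants of the frame `u i • E i` coming from the derivatives
`q i = E_0 (φ i)`, where `u i = (φ i)⁻¹`. -/
def rescalingTerm (q u : Fin n → ℝ) (i j k : Fin n) : ℝ :=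
  if i = 0 ∧ j = k then q k * (u i * u j) else 0

/-- The structure constants of the frame `u i • E i` in terms of those of `E`. -/
def rescaledStructure (f u q : Fin n → ℝ) (c : Fin n → Fin n → Fin n → ℝ) (i j k : Fin n) : ℝ :=
  f k * (u i * u j) * c i j k - rescalingTerm q u i j k + rescalingTerm q u j i k

/-- The value of the form dual to `E 0` on `u a • E a`. -/
def dualValue (u : Fin n → ℝ) (a : Fin n) : ℝ := if a = 0 then u a else 0

/-- The derivative of `u i * u j` along `u a • E a`. -/
def derivMul (u q : Fin n → ℝ) (a i j : Fin n) : ℝ :=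
  -(u i * u i * (q i * dualValue u a)) * u j + u i * -(u j * u j * (q j * dualValue u a))

/-- The derivative of `rescalingTerm` along `u a • E a` when `q` is held fixed. -/
def derivRescalingTerm (u q : Fin n → ℝ) (a i j k : Fin n) : ℝ :=
  if i = 0 ∧ j = k then q k * derivMul u q a i j else 0

/-- The part of the derivative of `rescaledStructure` along `u a • E a` that is free of second
derivatives of the rescaling functions. -/
def derivRescaledStructure (f u q : Fin n → ℝ) (c : Fin n → Fin n → Fin n → ℝ)
    (d : Fin n → Fin n → Fin n → Fin n → ℝ) (a i j k : Fin n) : ℝ :=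
  (q k * dualValue u a * (u i * u j) + f k * derivMul u q a i j) * c i j k
    + f k * (u i * u j) * (u a * d a i j k)
    - derivRescalingTerm u q a i j k + derivRescalingTerm u q a j i k

/-- The part of the derivative of `rescaledStructure` along `u a • E a` that contains the second
derivatives `r` of the rescaling functions. -/
def secondOrderTerm (u r : Fin n → ℝ) (a i j k : Fin n) : ℝ :=
  rescalingTerm (fun m => r m * dualValue u a) u j i k
    - rescalingTerm (fun m => r m * dualValue u a) u i j k

theorem secondOrderTerm_of_ne_zero (u r : Fin n → ℝ) {a : Fin n} (ha : a ≠ 0) (i j k : Fin n) :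
    secondOrderTerm u r a i j k = 0 := by
  simp [secondOrderTerm, rescalingTerm, dualValue, ha]

/-- The second-order entries live at positions `(0, m, m)` and `(m, 0, m)`. With `j ≠ 0`, a cyclic
permutation of `(j, k, l)` has this shape only in the two excluded cases. -/
theorem connCoeff_secondOrderTerm_zero (u r : Fin n → ℝ) {j k l : Fin n} (hj : j ≠ 0)
    (h₁ : ¬ (k = 0 ∧ j = l)) (h₂ : ¬ (l = 0 ∧ j = k)) :
    connCoeff (secondOrderTerm u r 0) j k l = 0 := by
  have h₁' : ¬ (k = 0 ∧ l = j) := fun h => h₁ ⟨h.1, h.2.symm⟩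
  have h₂' : ¬ (l = 0 ∧ k = j) := fun h => h₂ ⟨h.1, h.2.symm⟩
  simp [connCoeff, secondOrderTerm, rescalingTerm, hj, h₁, h₂, h₁', h₂']

/-- If neither `i` nor `j` is `0`, nothing is differentiated along `E'_0`; if both are, the two
terms cancel. In the mixed cases a surviving term would make the quadruple reduce to `(0, m, m, 0)`.
-/
theorem connCoeff_secondOrderTerm_sub (u r : Fin n → ℝ) {i j k l : Fin n}
    (h : ¬ ReducesTo 0 i j k l) :
    connCoeff (secondOrderTerm u r i) j k l - connCoeff (secondOrderTerm u r j) i k l = 0 := by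
  have hz {a b : Fin n} (ha : a ≠ 0) : connCoeff (secondOrderTerm u r a) b k l = 0 := by
    simp [connCoeff, secondOrderTerm_of_ne_zero u r ha]
  by_cases hi : i = 0 <;> by_cases hj : j = 0
  · rw [hi, hj, sub_self]
  · subst hi
    rw [hz hj, connCoeff_secondOrderTerm_zero u r hj, sub_zero]
    · rintro ⟨rfl, rfl⟩; exact h (.swapRight (.base _))
    · rintro ⟨rfl, rfl⟩; exact h (.base _)
  · subst hj
    rw [hz hi, connCoeff_secondOrderTerm_zero u r hi, sub_zero]
    · rintro ⟨rfl, rfl⟩; exact h (.swapLeft (.swapRight (.base _)))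
    · rintro ⟨rfl, rfl⟩; exact h (.swapLeft (.base _))
  · rw [hz hi, hz hj, sub_zero]

theorem curvForm_rescaled_one (c : Fin n → Fin n → Fin n → ℝ)
    (d : Fin n → Fin n → Fin n → Fin n → ℝ) (i j k l : Fin n) :
    curvForm (rescaledStructure 1 1 0 c) (derivRescaledStructure 1 1 0 c d) i j k l
      = curvForm c d i j k l := by
  have hc : rescaledStructure 1 1 0 c = c := by
    ext i j k; simp [rescaledStructure, rescalingTerm]
  have hd : derivRescaledStructure 1 1 0 c d = d := by
    ext a i j k; simp [derivRescaledStructure, derivRescalingTerm, derivMul]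
  rw [hc, hd]

variable {T : Type*} [TopologicalSpace T] {t : T} {f u q : T → Fin n → ℝ}
  {c : T → Fin n → Fin n → Fin n → ℝ} {d : T → Fin n → Fin n → Fin n → Fin n → ℝ}

/-- With `u` independent of `f` the expression is polynomial; the inverse is handled only where `u =
f⁻¹` is substituted. -/
theorem ContinuousAt.rescaledStructure (hf : ContinuousAt f t) (hu : ContinuousAt u t)
    (hq : ContinuousAt q t) (hc : ∀ i j k, ContinuousAt (fun y => c y i j k) t) (i j k : Fin n) :
    ContinuousAt (fun y => rescaledStructure (f y) (u y) (q y) (c y) i j k) t := by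
  have hf' := continuousAt_pi.1 hf
  have hu' := continuousAt_pi.1 hu
  have hq' := continuousAt_pi.1 hq
  unfold _root_.rescaledStructure rescalingTerm
  split_ifs <;> fun_prop

theorem ContinuousAt.derivRescaledStructure (hf : ContinuousAt f t) (hu : ContinuousAt u t)
    (hq : ContinuousAt q t) (hc : ∀ i j k, ContinuousAt (fun y => c y i j k) t)
    (hd : ∀ a i j k, ContinuousAt (fun y => d y a i j k) t) (a i j k : Fin n) :
    ContinuousAt (fun y => derivRescaledStructure (f y) (u y) (q y) (c y) (d y) a i j k) t := by
  have hf' := continuousAt_pi.1 hf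
  have hu' := continuousAt_pi.1 hu
  have hq' := continuousAt_pi.1 hq
  unfold _root_.derivRescaledStructure derivRescalingTerm derivMul dualValue
  split_ifs <;> fun_prop

/-- Near the trivial rescaling, the part of the curvature of the rescaled frame that is free of
second derivatives of the rescaling functions is uniformly close to the original curvature. -/
theorem exists_curvForm_rescaled_sub_lt {K : Set T} (hK : IsCompact K)
    (hc : ∀ t ∈ K, ∀ i j k, ContinuousAt (fun y => c y i j k) t)
    (hd : ∀ t ∈ K, ∀ a i j k, ContinuousAt (fun y => d y a i j k) t) {ε : ℝ} (hε : 0 < ε) :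
    ∃ δ > 0, ∀ f q : Fin n → ℝ, (∀ i, |f i - 1| < δ) → (∀ i, |q i| ≤ δ) → ∀ t ∈ K,
      ∀ i j k l, |curvForm (rescaledStructure f f⁻¹ q (c t))
          (derivRescaledStructure f f⁻¹ q (c t) (d t)) i j k l
        - curvForm (c t) (d t) i j k l| < ε := by
  have key : ∀ᶠ p : (Fin n → ℝ) × (Fin n → ℝ) in 𝓝 (1, 0), ∀ t ∈ K, ∀ i j k l,
      |curvForm (rescaledStructure p.1 p.1⁻¹ p.2 (c t))
          (derivRescaledStructure p.1 p.1⁻¹ p.2 (c t) (d t)) i j k l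
        - curvForm (c t) (d t) i j k l| < ε := by
    -- Tube-lemma argument: joint continuity at each `((1, 0), t)` gives one neighbourhood of `(1,
    -- 0)` valid for all of `K`.
    refine hK.eventually_forall_of_forall_eventually fun t ht => ?_
    simp only [Filter.eventually_all]
    intro i j k l
    have hf : ContinuousAt (fun z : ((Fin n → ℝ) × (Fin n → ℝ)) × T => z.1.1) ((1, 0), t) := by
      fun_prop
    have hu : ContinuousAt (fun z : ((Fin n → ℝ) × (Fin n → ℝ)) × T => z.1.1⁻¹) ((1, 0), t) := by
      refine continuousAt_pi.2 fun i => ?_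
      simp only [Pi.inv_apply]
      exact ContinuousAt.inv₀ (by fun_prop) (by simp)
    have hq : ContinuousAt (fun z : ((Fin n → ℝ) × (Fin n → ℝ)) × T => z.1.2) ((1, 0), t) := by
      fun_prop
    have hc' (i j k) : ContinuousAt
        (fun z : ((Fin n → ℝ) × (Fin n → ℝ)) × T => c z.2 i j k) ((1, 0), t) :=
      (hc t ht i j k).tendsto.comp continuousAt_snd
    have hd' (a i j k) : ContinuousAt
        (fun z : ((Fin n → ℝ) × (Fin n → ℝ)) × T => d z.2 a i j k) ((1, 0), t) :=
      (hd t ht a i j k).tendsto.comp continuousAt_snd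
    have hcont := ((ContinuousAt.curvForm (ContinuousAt.rescaledStructure hf hu hq hc')
      (ContinuousAt.derivRescaledStructure hf hu hq hc' hd') i j k l).sub
      (ContinuousAt.curvForm hc' hd' i j k l)).abs
    refine hcont.eventually_lt continuousAt_const ?_
    simpa [curvForm_rescaled_one] using hε
  obtain ⟨r, hr, H⟩ := Metric.eventually_nhds_iff.1 key
  -- Halving turns the non-strict bound on `q` into membership in the open ball of radius `r`.
  refine ⟨r / 2, half_pos hr, fun f q hf hq t ht => H (y := (f, q)) ?_ t ht⟩
  rw [Prod.dist_eq, max_lt_iff]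
  constructor
  · refine (dist_pi_lt_iff hr).2 fun i => ?_
    rw [Real.dist_eq]
    exact (hf i).trans (half_lt_self hr)
  · refine (dist_pi_lt_iff hr).2 fun i => ?_
    rw [Real.dist_eq]
    simpa using (hq i).trans_lt (half_lt_self hr)

end StructureConstants

/-! ### Geometry of the rescaled frame. -/

section Rescaling

theorem rescaling_ne_zero {n : ℕ} {M : Type*} [TopologicalSpace M]
    [ChartedSpace (EuclideanSpace ℝ (Fin n)) M] {U : Set M} {E' : Fin n → VField n M}
    {θ : Fin n → (x : M) → TangentSpace (𝓡 n) x →L[ℝ] ℝ} {φ : Fin n → M → ℝ}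
    (hθ' : IsDualCoframe U E' (fun i x => φ i x • θ i x)) {x : M} (hx : x ∈ U) (i : Fin n) :
    φ i x ≠ 0 := by
  intro h
  simpa [h] using hθ' x hx i i

variable {n : ℕ} {M : Type*} [TopologicalSpace M]
  [ChartedSpace (EuclideanSpace ℝ (Fin n)) M] [IsManifold (𝓡 n) ∞ M]

theorem IsOrthonormalFrame.eq_inv_smul {g : SmoothMetric n M} {U : Set M} {E E' : Fin n → VField n M}
    (hE : IsOrthonormalFrame g U E) {θ : Fin n → (x : M) → TangentSpace (𝓡 n) x →L[ℝ] ℝ}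
    (hθ : IsDualCoframe U E θ) {φ : Fin n → M → ℝ}
    (hθ' : IsDualCoframe U E' (fun i x => φ i x • θ i x)) {x : M} (hx : x ∈ U) (j : Fin n) :
    E' j x = (φ j x)⁻¹ • E j x := by
  have hco (m : Fin n) : g.inner x (E' j x) (E m x) = if m = j then (φ j x)⁻¹ else 0 := by
    have h1 : θ m x (E' j x) = g.inner x (E' j x) (E m x) := by
      conv_lhs => rw [← hE.exists_sum_eq hx (E' j x)]
      simp [hθ x hx]
    have h2 : φ m x * θ m x (E' j x) = if m = j then 1 else 0 := hθ' x hx m j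
    rw [← h1, eq_comm, ← mul_right_inj' (rescaling_ne_zero hθ' hx m), h2]
    split_ifs with h
    · rw [h, mul_inv_cancel₀ (rescaling_ne_zero hθ' hx j)]
    · simp
  rw [← hE.exists_sum_eq hx (E' j x)]
  simp [hco]

variable [NeZero n]

/-- `E'` is the orthonormal frame of `g'` obtained by rescaling the coframe dual to `E` by functions
`φ i` whose derivatives `ψ i`, and whose second derivatives `lam i`, are along the first form. -/
structure IsRescaledFrame (g g' : SmoothMetric n M) (U : Set M) (E E' : Fin n → VField n M)
    (θ : Fin n → (x : M) → TangentSpace (𝓡 n) x →L[ℝ] ℝ) (φ ψ lam : Fin n → M → ℝ) : Prop where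
  isOpen : IsOpen U
  frame : IsOrthonormalFrame g U E
  frame' : IsOrthonormalFrame g' U E'
  dual : IsDualCoframe U E θ
  dual' : IsDualCoframe U E' (fun i x => φ i x • θ i x)
  smooth : ∀ i, ContMDiffOn (𝓡 n) 𝓘(ℝ, ℝ) ∞ (φ i) U
  smooth_deriv : ∀ i, ContMDiffOn (𝓡 n) 𝓘(ℝ, ℝ) ∞ (ψ i) U
  deriv : ∀ i, ∀ x ∈ U, mvfderiv (𝓡 n) (φ i) x = ψ i x • θ 0 x
  deriv_deriv : ∀ i, ∀ x ∈ U, mvfderiv (𝓡 n) (ψ i) x = lam i x • θ 0 x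

namespace IsRescaledFrame

variable {g g' : SmoothMetric n M} {U : Set M} {E E' : Fin n → VField n M}
  {θ : Fin n → (x : M) → TangentSpace (𝓡 n) x →L[ℝ] ℝ} {φ ψ lam : Fin n → M → ℝ}

theorem ne_zero (h : IsRescaledFrame g g' U E E' θ φ ψ lam) {x : M} (hx : x ∈ U) (i : Fin n) :
    φ i x ≠ 0 := rescaling_ne_zero h.dual' hx i

theorem eq_inv_smul (h : IsRescaledFrame g g' U E E' θ φ ψ lam) {x : M} (hx : x ∈ U) (i : Fin n) :
    E' i x = (φ i x)⁻¹ • E i x := h.frame.eq_inv_smul h.dual h.dual' hx i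

theorem hasDirDeriv (h : IsRescaledFrame g g' U E E' θ φ ψ lam) {x : M} (hx : x ∈ U)
    (v : TangentSpace (𝓡 n) x) (i : Fin n) : HasDirDeriv (φ i) x v (ψ i x * θ 0 x v) :=
  ⟨((h.smooth i).contMDiffAt (h.isOpen.mem_nhds hx)).mdifferentiableAt (by simp),
    by rw [h.deriv i x hx]; rfl⟩

theorem hasDirDeriv_deriv (h : IsRescaledFrame g g' U E E' θ φ ψ lam) {x : M} (hx : x ∈ U)
    (v : TangentSpace (𝓡 n) x) (i : Fin n) : HasDirDeriv (ψ i) x v (lam i x * θ 0 x v) :=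
  ⟨((h.smooth_deriv i).contMDiffAt (h.isOpen.mem_nhds hx)).mdifferentiableAt (by simp),
    by rw [h.deriv_deriv i x hx]; rfl⟩

theorem hasDirDeriv_inv (h : IsRescaledFrame g g' U E E' θ φ ψ lam) {x : M} (hx : x ∈ U)
    (v : TangentSpace (𝓡 n) x) (i : Fin n) :
    HasDirDeriv (fun y => (φ i y)⁻¹) x v
      (-((φ i x)⁻¹ * (φ i x)⁻¹ * (ψ i x * θ 0 x v))) :=
  (h.hasDirDeriv hx v i).inv (h.ne_zero hx i)

theorem inner_frame (h : IsRescaledFrame g g' U E E' θ φ ψ lam) {x : M} (hx : x ∈ U)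
    (i k : Fin n) : g'.inner x (E i x) (E' k x) = if i = k then φ k x else 0 := by
  have : E i x = φ i x • E' i x := by
    rw [h.eq_inv_smul hx, smul_smul, mul_inv_cancel₀ (h.ne_zero hx i), one_smul]
  rw [this]
  simp only [map_smul, _root_.smul_apply, h.frame'.orthonormal x hx, smul_eq_mul]
  split_ifs with hik <;> simp [hik]

/-- Expand `[u_i E_i, u_j E_j]` by Leibniz. Since `E_i u_j = -u_j² ψ_j` for `i = 0` and vanishes
otherwise, pairing with `E'_k` through `inner_frame` leaves `rescalingTerm`. -/
theorem structureFun_eq (h : IsRescaledFrame g g' U E E' θ φ ψ lam) {x : M} (hx : x ∈ U)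
    (i j k : Fin n) :
    structureFun g' E' i j k x = rescaledStructure (fun i => φ i x) (fun i => (φ i x)⁻¹)
      (fun i => ψ i x) (fun i j k => structureFun g E i j k x) i j k := by
  have hev (i : Fin n) : E' i =ᶠ[𝓝 x] (fun y => (φ i y)⁻¹) • E i := by
    filter_upwards [h.isOpen.mem_nhds hx] with y hy using h.eq_inv_smul hy i
  have hd (i : Fin n) := (h.hasDirDeriv_inv hx 0 i).1
  have hE (i : Fin n) := h.frame.diffAt h.isOpen hx i
  have hb : g'.inner x (VectorField.mlieBracket (𝓡 n) (E i) (E j) x) (E' k x)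
      = structureFun g E i j k x * φ k x := by
    rw [← h.frame.exists_sum_eq hx (VectorField.mlieBracket (𝓡 n) (E i) (E j) x)]
    simp [h.inner_frame hx, structureFun, metricPair]
  have hθ (a : Fin n) : θ 0 x (E a x) = if a = 0 then 1 else 0 := by
    simp [h.dual x hx, eq_comm]
  rw [structureFun, metricPair, (hev i).mlieBracket_vectorField_eq (hev j),
    VectorField.mlieBracket_smul_left (hd i) (hE i),
    VectorField.mlieBracket_smul_right (hd j) (hE j)]
  have hj := h.ne_zero hx j
  have hi := h.ne_zero hx i
  simp only [Pi.smul_apply', map_add, map_smul, _root_.add_apply, _root_.smul_apply,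
    h.inner_frame hx, hb, (h.hasDirDeriv_inv hx _ _).2, hθ, smul_eq_mul, rescaledStructure,
    rescalingTerm, neg_smul, map_neg, _root_.neg_apply]
  split_ifs <;> simp_all <;> field_simp <;> ring

theorem dual_apply (h : IsRescaledFrame g g' U E E' θ φ ψ lam) {x : M} (hx : x ∈ U)
    (a : Fin n) : θ 0 x (E' a x) = dualValue (fun i => (φ i x)⁻¹) a := by
  rw [h.eq_inv_smul hx, map_smul, h.dual x hx]
  simp [dualValue, eq_comm]

/-- Product rule: differentiating the factor `ψ` gives the `lam` part, differentiating the inverses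
gives only first-order data. -/
theorem rescalingTerm_hasDirDeriv (h : IsRescaledFrame g g' U E E' θ φ ψ lam) {x : M} (hx : x ∈ U)
    (a i j k : Fin n) :
    HasDirDeriv (fun y => rescalingTerm (fun i => ψ i y) (fun i => (φ i y)⁻¹) i j k) x (E' a x)
      (rescalingTerm (fun m => lam m x * dualValue (fun i => (φ i x)⁻¹) a)
          (fun i => (φ i x)⁻¹) i j k
        + derivRescalingTerm (fun i => (φ i x)⁻¹) (fun i => ψ i x) a i j k) := by
  unfold rescalingTerm derivRescalingTerm derivMul
  rw [← h.dual_apply hx]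
  split_ifs
  · exact (h.hasDirDeriv_deriv hx _ k).mul
      ((h.hasDirDeriv_inv hx _ i).mul (h.hasDirDeriv_inv hx _ j))
  · simpa using HasDirDeriv.const 0

theorem mvfderiv_structureFun (h : IsRescaledFrame g g' U E E' θ φ ψ lam) {x : M} (hx : x ∈ U)
    (a i j k : Fin n) :
    mvfderiv (𝓡 n) (structureFun g' E' i j k) x (E' a x)
      = derivRescaledStructure (fun i => φ i x) (fun i => (φ i x)⁻¹) (fun i => ψ i x)
          (fun i j k => structureFun g E i j k x)
          (fun a i j k => mvfderiv (𝓡 n) (structureFun g E i j k) x (E a x)) a i j k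
        + secondOrderTerm (fun i => (φ i x)⁻¹) (fun i => lam i x) a i j k := by
  have hc : HasDirDeriv (structureFun g E i j k) x (E' a x) _ :=
    .of_mdifferentiableAt (h.frame.structureFun_diffAt h.isOpen hx i j k)
  have hmain := (((((h.hasDirDeriv hx (E' a x) k).mul ((h.hasDirDeriv_inv hx _ i).mul
    (h.hasDirDeriv_inv hx _ j))).mul hc).sub (h.rescalingTerm_hasDirDeriv hx a i j k)).add
    (h.rescalingTerm_hasDirDeriv hx a j i k))
  rw [(hmain.congr_of_eventuallyEq (h := structureFun g' E' i j k) ?_).2]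
  · rw [h.dual_apply hx, h.eq_inv_smul hx a, map_smul]
    simp only [derivRescaledStructure, secondOrderTerm, derivMul, smul_eq_mul]
    ring
  · filter_upwards [h.isOpen.mem_nhds hx] with y hy using h.structureFun_eq hy i j k

theorem riemannCurvature_eq (h : IsRescaledFrame g g' U E E' θ φ ψ lam) {x : M} (hx : x ∈ U)
    {i j k l : Fin n} (hr : ¬ ReducesTo 0 i j k l) :
    riemannCurvature g' (E' i) (E' j) (E' k) (E' l) x
      = curvForm (rescaledStructure (fun i => φ i x) (fun i => φ i x)⁻¹ (fun i => ψ i x)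
          (fun i j k => structureFun g E i j k x))
        (derivRescaledStructure (fun i => φ i x) (fun i => φ i x)⁻¹ (fun i => ψ i x)
          (fun i j k => structureFun g E i j k x)
          (fun a i j k => mvfderiv (𝓡 n) (structureFun g E i j k) x (E a x))) i j k l := by
  rw [h.frame'.riemannCurvature_eq_curvForm h.isOpen hx]
  simp only [h.structureFun_eq hx, h.mvfderiv_structureFun hx]
  rw [curvForm_add, connCoeff_secondOrderTerm_sub _ _ hr, add_zero]
  rfl

/-- Test the bound on `dφ_i` against the unit vector `E_0`, where it evaluates to `ψ_i`. -/
theorem abs_deriv_le (h : IsRescaledFrame g g' U E E' θ φ ψ lam) {x : M} (hx : x ∈ U) {δ : ℝ}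
    {i : Fin n} (hφ : C1CloseToOneAt g δ (φ i) x) : |ψ i x| ≤ δ := by
  have := hφ.2 (E 0 x)
  rw [(h.hasDirDeriv hx _ i).2, h.dual x hx, h.frame.orthonormal x hx] at this
  simpa using this

end IsRescaledFrame

end Rescaling

end

/-! ### The curvature estimate. -/

theorem mainTheorem4 {n : ℕ} [NeZero n] {M : Type*} [TopologicalSpace M]
    [ChartedSpace (EuclideanSpace ℝ (Fin n)) M] [IsManifold (𝓡 n) ∞ M]
    (g : SmoothMetric n M) (U : Set M) (hU : IsOpen U)
    (E : Fin n → VField n M) (hE : IsOrthonormalFrame g U E)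
    (θ : Fin n → (x : M) → TangentSpace (𝓡 n) x →L[ℝ] ℝ) (hθ : IsDualCoframe U E θ)
    (K : Set M) (hK : IsCompact K) (hKU : K ⊆ U) (ε : ℝ) (hε : 0 < ε) :
    ∃ δ > 0, ∀ (φ ψ lam : Fin n → M → ℝ),
      (∀ i, ContMDiffOn (𝓡 n) 𝓘(ℝ, ℝ) ∞ (φ i) U) →
      (∀ i, ContMDiffOn (𝓡 n) 𝓘(ℝ, ℝ) ∞ (ψ i) U) →
      (∀ i, ContMDiffOn (𝓡 n) 𝓘(ℝ, ℝ) ∞ (lam i) U) →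
      (∀ i, ∀ x ∈ U, mvfderiv (𝓡 n) (φ i) x = ψ i x • θ 0 x) →
      (∀ i, ∀ x ∈ U, mvfderiv (𝓡 n) (ψ i) x = lam i x • θ 0 x) →
      ∀ (g' : SmoothMetric n M) (E' : Fin n → VField n M),
        IsOrthonormalFrame g' U E' →
        IsDualCoframe U E' (fun i x => φ i x • θ i x) →
        ∀ x ∈ K, (∀ i, C1CloseToOneAt g δ (φ i) x) →
          ∀ i j k l, ¬ ReducesTo 0 i j k l →
            |riemannCurvature g' (E' i) (E' j) (E' k) (E' l) x
              - riemannCurvature g (E i) (E j) (E k) (E l) x| < ε := by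
  have hc (i j k : Fin n) := hE.structureFun_contMDiffOn hU i j k
  -- Here `c` and `d` come from `g` and `E` alone, so `δ` is fixed before `φ`, `ψ`, `lam` and `g'`
  -- appear.
  obtain ⟨δ, hδ, H⟩ := exists_curvForm_rescaled_sub_lt
    (c := fun x i j k => structureFun g E i j k x)
    (d := fun x a i j k => mvfderiv (𝓡 n) (structureFun g E i j k) x (E a x)) hK
    (fun x hx i j k => (hc i j k).continuousOn.continuousAt (hU.mem_nhds (hKU hx)))
    (fun x hx a i j k => (hE.mvfderiv_contMDiffOn hU (hc i j k) a).continuousOn.continuousAt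
      (hU.mem_nhds (hKU hx))) hε
  refine ⟨δ, hδ, fun φ ψ lam hφ hψ _ hdφ hdψ g' E' hE' hθ' x hx hclose i j k l hr => ?_⟩
  have h : IsRescaledFrame g g' U E E' θ φ ψ lam := ⟨hU, hE, hE', hθ, hθ', hφ, hψ, hdφ, hdψ⟩
  rw [h.riemannCurvature_eq (hKU hx) hr, hE.riemannCurvature_eq_curvForm hU (hKU hx)]
  exact H _ _ (fun i => (hclose i).1) (fun i => h.abs_deriv_le (hKU hx) (hclose i)) x hx i j k l
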